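/- For integers $n \ge k \ge 0$ and $t$, let $J_{\pm}(n,k,t)$ be the graph whose vertices are the vectors in $\{-1,0,1\}^n$ with exactly $k$ nonzero coordinates, two distinct vertices being adjacent if and only if their scalar product equals $t$. Let $\alpha(G)$ denote the independence number of a graph $G$, that is, the maximal size of a set of vertices no two of which are adjacent. Then for every integer $n \ge 9$, \[ \alpha\bigl(J_{\pm}(n,3,0)\bigr) = 2\binom{n-1}{2}. \] -/

import Mathlib

/-- The vertices of the signed Johnson graph: vectors of length `n` with entries in `{-1, 0, 1}`,
exactly `k` of which are nonzero. -/
abbrev SignedJohnsonVertex (n k : ℕ) : Type :=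
  {v : Fin n → ℤ //
    (∀ i, v i ∈ ({-1, 0, 1} : Set ℤ)) ∧ (Finset.univ.filter fun i => v i ≠ 0).card = k}

/-- The graph `J_±(n, k, t)`: two distinct vertices are adjacent if and only if their scalar
product equals `t`. -/
def signedJohnsonGraph (n k : ℕ) (t : ℤ) : SimpleGraph (SignedJohnsonVertex n k) where
  Adj v w := v ≠ w ∧ v.1 ⬝ᵥ w.1 = t
  symm := ⟨fun v w h => ⟨h.1.symm, (dotProduct_comm w.1 v.1).trans h.2⟩⟩
  loopless := ⟨fun _ h => h.1 rfl⟩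

/-- There are finitely many vertices. -/
instance instFiniteSignedJohnsonVertex (n k : ℕ) : Finite (SignedJohnsonVertex n k) :=
  ((Set.Finite.pi' fun _ : Fin n => Set.toFinite ({-1, 0, 1} : Set ℤ)).subset
    fun _ h => h.1).to_subtype

/-!
The lower bound comes from the vectors with a fixed coordinate in their support whose three nonzero
entries are equal: two such vectors have scalar product plus or minus the size of the intersection
of their supports, which is not `0`.

For the upper bound, let `S` be an independent set and let `w T` be the number of vectors in `S`
with support `T`. The supports are pairwise intersecting triples. If two distinct supports share
exactly a pair, then the product of the two signs on this pair is the same for all vectors with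
these supports. Hence `w T ≤ 8` always, `w T ≤ 4` if one pair of `T` lies in another support, and
`w T ≤ 2` if two pairs do (`isSignWeight_of_isIndepSet`). From here on only these inequalities are
used (`IsSignWeight`), to show that the total weight is at most `(n - 1) * (n - 2)` for `n ≥ 9`.

* If all triples share a point `x`, they form a graph on the other `n - 1` points, and the bound
  follows by charging edges to their ends (`IsSignWeight.total_le_of_star`).
* If they have no common point and the triples through each pair weigh at most `8`, then the triples
  through a point `a` weigh at most `24`, because they all meet a triple that avoids `a`. Together
  with the fact that two triples `{a, b, c}`, `{a, b, d}` force every other triple to contain `a`,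
  or `b`, or both `c` and `d`, this bounds the total by `24 + 24 + 8 = 56`; without two such triples
  a similar count gives `8 + 3 * 16 = 56` (`IsSignWeight.total_le_of_light`).
* If the triples through some pair `{p, q}` weigh more than `8`, then this pair meets every triple
  but at most one, and the total weight is bounded by a linear function of `n`
  (`IsSignWeight.total_le_of_heavy`). The triples `{p, q, z}` weigh at most `4` each, and at most `2`
  when `z` lies in a triple that contains only one of `p` and `q`. The triples `{a, x, z}` and
  `{a, y, z}` together contribute about `4` for each `z` (`IsSignWeight.sum_two_pairs_le`).

For `n = 9` the value `(n - 1) * (n - 2)` is `56`, which is also what the estimates give in the last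
two cases, so this is where the hypothesis `n ≥ 9` is needed.
-/

/-! ### Weights on intersecting triples -/

/-- A weight on finite sets that obeys the constraints satisfied by
`T ↦ #{v ∈ S | v has support T}` for an independent set `S` of `J_±(n, 3, 0)`: the sets of nonzero
weight are pairwise intersecting triples, a triple has weight at most `8`, at most `4` if one of its
pairs lies in another triple of nonzero weight, and at most `2` if two of its pairs do. -/
structure IsSignWeight {α : Type*} [DecidableEq α] (w : Finset α → ℕ) : Prop where
  card_eq : ∀ {T}, w T ≠ 0 → T.card = 3
  inter : ∀ {S T}, w S ≠ 0 → w T ≠ 0 → ∃ a, a ∈ S ∧ a ∈ T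
  le_eight : ∀ T, w T ≤ 8
  le_four : ∀ {a b S T}, a ≠ b → a ∈ S → b ∈ S → a ∈ T → b ∈ T → w T ≠ 0 → S ≠ T → w S ≤ 4
  le_two : ∀ {a b c S T U}, a ≠ b → a ≠ c → b ≠ c → a ∈ S → b ∈ S → c ∈ S →
    a ∈ T → b ∈ T → w T ≠ 0 → S ≠ T → a ∈ U → c ∈ U → w U ≠ 0 → S ≠ U → w S ≤ 2

open Classical in
/-- The total weight of the sets with property `Q`. -/
noncomputable def mass {α : Type*} [Fintype α] (w : Finset α → ℕ) (Q : Finset α → Prop) : ℕ :=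
  ∑ T with Q T, w T

section Mass

variable {α : Type*} [Fintype α] {w : Finset α → ℕ}

theorem mass_le_add {Q R S : Finset α → Prop} (h : ∀ T, w T ≠ 0 → Q T → R T ∨ S T) :
    mass w Q ≤ mass w R + mass w S := by
  classical
  simp only [mass, Finset.sum_filter, ← Finset.sum_add_distrib]
  refine Finset.sum_le_sum fun T _ => ?_
  by_cases h0 : w T = 0
  · simp [h0]
  · have := h T h0
    split_ifs <;> simp_all

theorem mass_le_sum {Q : Finset α → Prop} {ι : Type*} (Z : Finset ι) (g : ι → Finset α)
    (h : ∀ T, w T ≠ 0 → Q T → ∃ z ∈ Z, T = g z) : mass w Q ≤ ∑ z ∈ Z, w (g z) := by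
  classical
  induction Z using Finset.induction_on generalizing Q with
  | empty =>
    refine (Finset.sum_eq_zero fun T hT => ?_).le
    by_contra h0
    simpa using h T h0 (by simpa using hT)
  | insert z Z hz ih =>
    rw [Finset.sum_insert hz]
    refine (mass_le_add (R := fun T => T = g z) (S := fun T => Q T ∧ T ≠ g z)
      fun T _ hQ => ?_).trans (add_le_add ?_ (ih fun T h0 hT => ?_))
    · by_cases hT : T = g z
      · exact .inl hT
      · exact .inr ⟨hQ, hT⟩
    · simp [mass, Finset.sum_filter]
    · obtain ⟨y, hy, rfl⟩ := h T h0 hT.1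
      rcases Finset.mem_insert.1 hy with rfl | hy
      · exact absurd rfl hT.2
      · exact ⟨y, hy, rfl⟩

end Mass

namespace IsSignWeight

variable {α : Type*} [DecidableEq α] {w : Finset α → ℕ} (hw : IsSignWeight w)
include hw

theorem exists_third {T : Finset α} {a b : α} (hT : w T ≠ 0) (hab : a ≠ b) (ha : a ∈ T)
    (hb : b ∈ T) : ∃ z, z ≠ a ∧ z ≠ b ∧ T = {a, b, z} := by
  have h : ((T.erase a).erase b).card = 1 := by
    rw [Finset.card_erase_of_mem (by simp [hab.symm, hb]), Finset.card_erase_of_mem ha,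
      hw.card_eq hT]
  obtain ⟨z, hz⟩ := Finset.card_eq_one.1 h
  have hz' : z ∈ (T.erase a).erase b := by simp [hz]
  simp only [Finset.mem_erase] at hz'
  refine ⟨z, hz'.2.1, hz'.1, ?_⟩
  rw [← hz, Finset.insert_erase (by simp [hab.symm, hb]), Finset.insert_erase ha]

theorem ne_of_pair {a b z : α} (h : w {a, b, z} ≠ 0) : a ≠ b ∧ a ≠ z ∧ b ≠ z := by
  have := hw.card_eq h
  refine ⟨?_, ?_, ?_⟩ <;> rintro rfl
  · have h2 : ({a, a, z} : Finset α).card ≤ 2 := by simpa using Finset.card_le_two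
    omega
  · have h2 : ({a, b, a} : Finset α).card ≤ 2 := by
      rw [Finset.pair_comm b a]; simpa using Finset.card_le_two
    omega
  · have h2 : ({a, b, b} : Finset α).card ≤ 2 := by simpa using Finset.card_le_two
    omega

theorem triple_ne {a b z y : α} (h : w {a, b, z} ≠ 0) (hzy : z ≠ y) :
    ({a, b, z} : Finset α) ≠ {a, b, y} := fun he => by
  have h1 := hw.ne_of_pair h
  have h2 : z ∈ ({a, b, y} : Finset α) := he ▸ (by simp)
  simp only [Finset.mem_insert, Finset.mem_singleton] at h2
  rcases h2 with h2 | h2 | h2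
  exacts [h1.2.1 h2.symm, h1.2.2 h2.symm, hzy h2]

/-- Two triples through the same pair. -/
theorem pair_le_four {a b z y : α} (hzy : z ≠ y) (hy : w {a, b, y} ≠ 0) :
    w {a, b, z} ≤ 4 := by
  by_cases h : w {a, b, z} = 0
  · omega
  · exact hw.le_four (hw.ne_of_pair h).1 (by simp) (by simp) (by simp) (by simp) hy
      (hw.triple_ne h hzy)

theorem sum_pair_le_eight {a b : α} {Z : Finset α} (hZ : Z.card ≤ 2) :
    ∑ z ∈ Z, w {a, b, z} ≤ 8 := by
  by_cases h : ∃ y ∈ Z, ∃ z ∈ Z, z ≠ y ∧ w {a, b, y} ≠ 0 ∧ w {a, b, z} ≠ 0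
  · obtain ⟨y, hy, z, hz, hzy, h1, h2⟩ := h
    have hall : ∀ x ∈ Z, w {a, b, x} ≤ 4 := fun x _ => by
      by_cases hx : x = y
      · exact hx ▸ hw.pair_le_four hzy.symm h2
      · exact hw.pair_le_four hx h1
    have := Finset.sum_le_card_nsmul Z _ 4 hall
    rw [smul_eq_mul] at this
    omega
  · push Not at h
    by_cases h0 : ∃ y ∈ Z, w {a, b, y} ≠ 0
    · obtain ⟨y, hy, h0⟩ := h0
      rw [Finset.sum_eq_single_of_mem y hy fun z hz hzy => h y hy z hz hzy h0]
      exact hw.le_eight _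
    · push Not at h0
      rw [Finset.sum_eq_zero h0]
      omega

variable [Fintype α]

theorem mass_pair_le {Q : Finset α → Prop} {a b : α} (hab : a ≠ b) (Z : Finset α)
    (hQ : ∀ T, w T ≠ 0 → Q T → a ∈ T ∧ b ∈ T)
    (hZ : ∀ z, z ≠ a → z ≠ b → w {a, b, z} ≠ 0 → Q {a, b, z} → z ∈ Z) :
    mass w Q ≤ ∑ z ∈ Z, w {a, b, z} := by
  refine mass_le_sum Z (fun z => {a, b, z}) fun T h0 hT => ?_
  obtain ⟨z, hza, hzb, rfl⟩ := hw.exists_third h0 hab (hQ T h0 hT).1 (hQ T h0 hT).2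
  exact ⟨z, hZ z hza hzb h0 hT, rfl⟩

/-- Each triple `{x, a, b}` is charged to `a` and `b`: a point pays `4` if it lies in only one
triple and `1` for each of its triples otherwise. No point other than `x` pays more than
`card α - 2`. -/
theorem total_le_of_star (hα : 6 ≤ Fintype.card α) (x : α) (hx : ∀ T, w T ≠ 0 → x ∈ T) :
    ∑ T, w T ≤ (Fintype.card α - 1) * (Fintype.card α - 2) := by
  set F : Finset (Finset α) := Finset.univ.filter fun T => w T ≠ 0 with hF
  let deg : α → ℕ := fun a => (F.filter fun T => a ∈ T).card
  let g : α → ℕ := fun a => if deg a = 1 then 4 else 1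
  have hother : ∀ T a, w T ≠ 0 → a ∈ T → deg a ≠ 1 → ∃ U, w U ≠ 0 ∧ a ∈ U ∧ T ≠ U := by
    intro T a hT ha hd
    by_contra! hno
    refine hd (Finset.card_eq_one.2 ⟨T, ?_⟩)
    ext U
    simp only [hF, Finset.mem_filter, Finset.mem_univ, true_and, Finset.mem_singleton]
    exact ⟨fun h => (hno U h.1 h.2).symm, fun h => h ▸ ⟨hT, ha⟩⟩
  have hcharge : ∀ T ∈ F, w T ≤ ∑ a ∈ T.erase x, g a := by
    intro T hT
    have h0 : w T ≠ 0 := by simpa [hF] using hT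
    have hxT := hx T h0
    have hc : (T.erase x).card = 2 := by rw [Finset.card_erase_of_mem hxT, hw.card_eq h0]
    obtain ⟨a, b, hab, he⟩ := Finset.card_eq_two.1 hc
    have ha : a ∈ T.erase x := by simp [he]
    have hb : b ∈ T.erase x := by simp [he]
    simp only [Finset.mem_erase] at ha hb
    rw [he, Finset.sum_pair hab]
    have h8 := hw.le_eight T
    by_cases hda : deg a = 1 <;> by_cases hdb : deg b = 1 <;> simp only [g, hda, hdb, if_true,
      if_false]
    · omega
    · obtain ⟨U, hU, hbU, hTU⟩ := hother T b h0 hb.2 hdb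
      have := hw.le_four hb.1.symm hxT hb.2 (hx U hU) hbU hU hTU
      omega
    · obtain ⟨U, hU, haU, hTU⟩ := hother T a h0 ha.2 hda
      have := hw.le_four ha.1.symm hxT ha.2 (hx U hU) haU hU hTU
      omega
    · obtain ⟨U, hU, haU, hTU⟩ := hother T a h0 ha.2 hda
      obtain ⟨V, hV, hbV, hTV⟩ := hother T b h0 hb.2 hdb
      exact hw.le_two ha.1.symm hb.1.symm hab hxT ha.2 hb.2 (hx U hU) haU hU hTU (hx V hV) hbV
        hV hTV
  have hdeg : ∀ a ∈ Finset.univ.erase x, deg a ≤ Fintype.card α - 2 := by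
    intro a ha
    have hax : x ≠ a := by simpa [eq_comm] using ha
    have hsub : (F.filter fun T => a ∈ T) ⊆
        ((Finset.univ.erase x).erase a).image fun z => {x, a, z} := by
      intro T hT
      simp only [hF, Finset.mem_filter, Finset.mem_univ, true_and] at hT
      obtain ⟨z, hz1, hz2, rfl⟩ := hw.exists_third hT.1 hax (hx T hT.1) hT.2
      exact Finset.mem_image.2 ⟨z, by simp [hz1, hz2], rfl⟩
    refine (Finset.card_le_card hsub).trans (Finset.card_image_le.trans ?_)
    rw [Finset.card_erase_of_mem (by simp [hax.symm]), Finset.card_erase_of_mem (by simp),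
      Finset.card_univ]
    omega
  calc ∑ T, w T = ∑ T ∈ F, w T := (Finset.sum_filter_ne_zero _).symm
    _ ≤ ∑ T ∈ F, ∑ a ∈ T.erase x, g a := Finset.sum_le_sum hcharge
    _ = ∑ a ∈ Finset.univ.erase x, ∑ T ∈ F.filter (fun T => a ∈ T), g a := by
        refine Finset.sum_comm' fun T a => ?_
        simp only [Finset.mem_erase, Finset.mem_filter, Finset.mem_univ]
        tauto
    _ = ∑ a ∈ Finset.univ.erase x, deg a * g a := by simp [deg]
    _ ≤ ∑ a ∈ Finset.univ.erase x, (Fintype.card α - 2) := by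
        refine Finset.sum_le_sum fun a ha => ?_
        have := hdeg a ha
        by_cases hda : deg a = 1
        · simp only [g, hda, if_true]; omega
        · simp only [g, hda, if_false]; omega
    _ = _ := by simp [Finset.card_erase_of_mem]

/-- A family without common point in which the triples through any pair have total weight at
most `8`. The seven lines of the Fano plane, with weight `8` each, attain the bound. -/
theorem total_le_of_light (hstar : ∀ x, ∃ T, w T ≠ 0 ∧ x ∉ T)
    (hlight : ∀ a b : α, a ≠ b → ∑ z, w {a, b, z} ≤ 8) : ∑ T, w T ≤ 56 := by
  have htot : ∑ T, w T = mass w fun _ => True := by simp [mass]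
  have hpair : ∀ a b, a ≠ b → mass w (fun T => a ∈ T ∧ b ∈ T) ≤ 8 := fun a b hab =>
    (hw.mass_pair_le hab Finset.univ (fun _ _ h => h) (by simp)).trans (hlight a b hab)
  by_cases hsh : ∃ a b c d, c ≠ d ∧ w {a, b, c} ≠ 0 ∧ w {a, b, d} ≠ 0
  · have hdeg : ∀ a, mass w (fun T => a ∈ T) ≤ 24 := by
      intro a
      obtain ⟨U, hU, haU⟩ := hstar a
      obtain ⟨x, y, z, -, -, -, rfl⟩ := Finset.card_eq_three.1 (hw.card_eq hU)
      simp only [Finset.mem_insert, Finset.mem_singleton, not_or] at haU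
      have h1 : mass w (fun T => a ∈ T) ≤ mass w (fun T => a ∈ T ∧ x ∈ T) +
          mass w (fun T => a ∈ T ∧ (y ∈ T ∨ z ∈ T)) := mass_le_add fun T hT haT => by
        obtain ⟨c, hc, hcT⟩ := hw.inter hU hT
        simp only [Finset.mem_insert, Finset.mem_singleton] at hc
        rcases hc with rfl | rfl | rfl <;> simp_all
      have h2 : mass w (fun T => a ∈ T ∧ (y ∈ T ∨ z ∈ T)) ≤ mass w (fun T => a ∈ T ∧ y ∈ T) +
          mass w (fun T => a ∈ T ∧ z ∈ T) := mass_le_add fun T hT haT => by tauto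
      have h3 := hpair a x haU.1
      have h4 := hpair a y haU.2.1
      have h5 := hpair a z haU.2.2
      omega
    obtain ⟨a, b, c, d, hcd, hc, hd⟩ := hsh
    have h1 : mass w (fun _ => True) ≤ mass w (fun T => a ∈ T) +
        mass w (fun T => b ∈ T ∨ (c ∈ T ∧ d ∈ T)) := mass_le_add fun T hT _ => by
      obtain ⟨x, hx, hxT⟩ := hw.inter hc hT
      obtain ⟨y, hy, hyT⟩ := hw.inter hd hT
      simp only [Finset.mem_insert, Finset.mem_singleton] at hx hy
      rcases hx with rfl | rfl | rfl <;> rcases hy with rfl | rfl | rfl <;> tauto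
    have h2 : mass w (fun T => b ∈ T ∨ (c ∈ T ∧ d ∈ T)) ≤ mass w (fun T => b ∈ T) +
        mass w (fun T => c ∈ T ∧ d ∈ T) := mass_le_add fun T hT h => h
    have h3 := hdeg a
    have h4 := hdeg b
    have h5 := hpair c d hcd
    omega
  · push Not at hsh
    by_cases hex : ∃ T, w T ≠ 0
    swap
    · push Not at hex
      simp [hex]
    obtain ⟨T₀, hT₀⟩ := hex
    have hdeg : ∀ a ∈ T₀, mass w (fun T => a ∈ T ∧ T ≠ T₀) ≤ 16 := by
      intro a ha
      obtain ⟨U, hU, haU⟩ := hstar a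
      obtain ⟨b, hbU, hb⟩ := hw.inter hU hT₀
      have hab : a ≠ b := fun h => haU (h ▸ hbU)
      have hb' : ∀ T, w T ≠ 0 → a ∈ T → T ≠ T₀ → b ∉ T := by
        intro T hT haT hTT hbT
        obtain ⟨c, -, -, rfl⟩ := hw.exists_third hT₀ hab ha hb
        obtain ⟨d, -, -, rfl⟩ := hw.exists_third hT hab haT hbT
        exact hT (hsh a b c d (fun h => hTT (h ▸ rfl)) hT₀)
      have hc : (U.erase b).card = 2 := by rw [Finset.card_erase_of_mem hbU, hw.card_eq hU]
      obtain ⟨y, z, -, he⟩ := Finset.card_eq_two.1 hc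
      have hyU : y ∈ U := Finset.mem_of_mem_erase (a := b) (by simp [he])
      have hzU : z ∈ U := Finset.mem_of_mem_erase (a := b) (by simp [he])
      have h1 : mass w (fun T => a ∈ T ∧ T ≠ T₀) ≤ mass w (fun T => a ∈ T ∧ y ∈ T) +
          mass w (fun T => a ∈ T ∧ z ∈ T) := mass_le_add fun T hT h => by
        obtain ⟨c, hc, hcT⟩ := hw.inter hU hT
        have hcb : c ≠ b := fun hcb => hb' T hT h.1 h.2 (hcb ▸ hcT)
        have hc' : c ∈ U.erase b := by simp [hcb, hc]
        rw [he] at hc'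
        simp only [Finset.mem_insert, Finset.mem_singleton] at hc'
        rcases hc' with rfl | rfl
        · exact .inl ⟨h.1, hcT⟩
        · exact .inr ⟨h.1, hcT⟩
      have h2 := hpair a y fun h => haU (h ▸ hyU)
      have h3 := hpair a z fun h => haU (h ▸ hzU)
      omega
    obtain ⟨a, b, c, -, -, -, he⟩ := Finset.card_eq_three.1 (hw.card_eq hT₀)
    have h1 : mass w (fun _ => True) ≤ mass w (fun T => T = T₀) + mass w (fun T => T ≠ T₀) :=
      mass_le_add fun T _ _ => em _
    have h2 : mass w (fun T => T ≠ T₀) ≤ mass w (fun T => a ∈ T ∧ T ≠ T₀) +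
        mass w (fun T => (b ∈ T ∨ c ∈ T) ∧ T ≠ T₀) := mass_le_add fun T hT h => by
      obtain ⟨x, hx, hxT⟩ := hw.inter hT₀ hT
      rw [he] at hx
      simp only [Finset.mem_insert, Finset.mem_singleton] at hx
      rcases hx with rfl | rfl | rfl <;> tauto
    have h3 : mass w (fun T => (b ∈ T ∨ c ∈ T) ∧ T ≠ T₀) ≤ mass w (fun T => b ∈ T ∧ T ≠ T₀) +
        mass w (fun T => c ∈ T ∧ T ≠ T₀) := mass_le_add fun T hT h => by tauto
    have h4 : mass w (fun T => T = T₀) ≤ 8 := by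
      simpa [mass, Finset.sum_filter] using hw.le_eight T₀
    have h5 := hdeg a (by simp [he])
    have h6 := hdeg b (by simp [he])
    have h7 := hdeg c (by simp [he])
    omega

end IsSignWeight

/-! ### Families with a heavy pair -/

/-- What makes `{p, q}` behave like a pair that lies in at least two triples of nonzero weight:
all triples through it have weight at most `4`, and at most `2` if their third point lies in a
further triple that contains exactly one of `p` and `q`. -/
structure IsHeavyPair {α : Type*} [DecidableEq α] (w : Finset α → ℕ) (p q : α) : Prop where
  ne : p ≠ q
  le_four : ∀ z, w {p, q, z} ≤ 4
  le_two_left : ∀ z T, w T ≠ 0 → z ≠ p → z ≠ q → z ∈ T → p ∈ T → q ∉ T → w {p, q, z} ≤ 2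
  le_two_right : ∀ z T, w T ≠ 0 → z ≠ p → z ≠ q → z ∈ T → q ∈ T → p ∉ T → w {p, q, z} ≤ 2

theorem IsHeavyPair.symm {α : Type*} [DecidableEq α] {w : Finset α → ℕ} {p q : α}
    (h : IsHeavyPair w p q) : IsHeavyPair w q p where
  ne := h.ne.symm
  le_four z := by rw [Finset.insert_comm]; exact h.le_four z
  le_two_left z T h0 hp hq := by rw [Finset.insert_comm]; exact h.le_two_right z T h0 hq hp
  le_two_right z T h0 hp hq := by rw [Finset.insert_comm]; exact h.le_two_left z T h0 hq hp

namespace IsSignWeight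

variable {α : Type*} [DecidableEq α] {w : Finset α → ℕ} (hw : IsSignWeight w)
include hw

theorem isHeavyPair_of_two {p q c₁ c₂ : α} (h₁ : w {p, q, c₁} ≠ 0) (h₂ : w {p, q, c₂} ≠ 0)
    (h12 : c₁ ≠ c₂) : IsHeavyPair w p q := by
  have hother : ∀ z, ∃ y, z ≠ y ∧ w {p, q, y} ≠ 0 := fun z => by
    by_cases hz : z = c₁
    · exact ⟨c₂, hz ▸ h12, h₂⟩
    · exact ⟨c₁, hz, h₁⟩
  have hpq := (hw.ne_of_pair h₁).1
  refine ⟨hpq, fun z => ?_, fun z T hT hzp hzq hz hp hq => ?_, fun z T hT hzp hzq hz hq hp => ?_⟩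
  · obtain ⟨y, hzy, hy⟩ := hother z
    exact hw.pair_le_four hzy hy
  · obtain ⟨y, hzy, hy⟩ := hother z
    by_cases h0 : w {p, q, z} = 0
    · omega
    exact hw.le_two (a := p) (b := q) (c := z) hpq hzp.symm hzq.symm (by simp) (by simp) (by simp)
      (by simp) (by simp) hy (hw.triple_ne h0 hzy) hp hz hT fun h => hq (h ▸ by simp)
  · obtain ⟨y, hzy, hy⟩ := hother z
    by_cases h0 : w {p, q, z} = 0
    · omega
    exact hw.le_two (a := q) (b := p) (c := z) hpq.symm hzq.symm hzp.symm (by simp) (by simp)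
      (by simp) (by simp) (by simp) hy (hw.triple_ne h0 hzy) hq hz hT fun h => hp (h ▸ by simp)

/-- For a point `z` outside `{a, x, y}`, the triples `{a, x, z}` and `{a, y, z}` together weigh at
most `4`, unless one of them is the only triple through `{a, x}` or `{a, y}`; the term `8` pays for
these two exceptions. The function `g` makes room for a third triple `{p, q, z}` through a heavy pair,
whose weight drops from `4` to `2` when one of the other two is present. -/
theorem sum_two_pairs_le {a x y : α} (hxy : x ≠ y) (Z : Finset α) (hxZ : x ∉ Z) (hyZ : y ∉ Z)
    (g : α → ℕ) (hg4 : ∀ z ∈ Z, g z ≤ 4)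
    (hg2 : ∀ z ∈ Z, w {a, x, z} ≠ 0 ∨ w {a, y, z} ≠ 0 → g z ≤ 2) :
    ∑ z ∈ Z, g z + ∑ z ∈ Z, w {a, x, z} + ∑ z ∈ Z, w {a, y, z} ≤ 6 * Z.card + 8 := by
  classical
  let only : α → α → Prop := fun b z => w {a, b, z} ≠ 0 ∧ ∀ z', w {a, b, z'} ≠ 0 → z' = z
  let e : α → α → ℕ := fun b z => if only b z then 4 else 0
  have he : ∀ b, ∑ z ∈ Z, e b z ≤ 4 := by
    intro b
    simp only [e]
    rw [← Finset.sum_filter, Finset.sum_const, smul_eq_mul]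
    refine (Nat.mul_le_mul_right 4 (Finset.card_le_one.2 fun z hz z' hz' => ?_)).trans
      (by norm_num : 1 * 4 ≤ 4)
    exact (Finset.mem_filter.1 hz').2.2 z (Finset.mem_filter.1 hz).2.1
  have hone : ∀ b z, w {a, b, z} ≤ 4 + e b z := by
    intro b z
    by_cases ho : only b z
    · simpa [e, ho] using hw.le_eight _
    · by_cases h0 : w {a, b, z} = 0
      · omega
      have : ∃ z', w {a, b, z'} ≠ 0 ∧ z' ≠ z := by
        by_contra! hno
        exact ho ⟨h0, hno⟩
      obtain ⟨z', h0', hz'⟩ := this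
      have := hw.pair_le_four (Ne.symm hz') h0'
      omega
  -- if both triples have weight, they share the pair `{a, z}`
  have htwo : ∀ b c z, b ≠ c → b ≠ z → c ≠ z → w {a, b, z} ≠ 0 → w {a, c, z} ≠ 0 →
      w {a, b, z} ≤ 2 + (e b z) / 2 := by
    intro b c z hbc hbz hcz hb hc
    have hnb := hw.ne_of_pair hb
    have hnc := hw.ne_of_pair hc
    have hne : ({a, b, z} : Finset α) ≠ {a, c, z} := fun h => by
      have : b ∈ ({a, c, z} : Finset α) := h ▸ by simp
      simp only [Finset.mem_insert, Finset.mem_singleton] at this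
      rcases this with h | h | h
      exacts [hnb.1 h.symm, hbc h, hbz h]
    by_cases ho : only b z
    · simp only [e, ho, if_true]
      exact hw.le_four hnb.2.1 (by simp) (by simp) (by simp) (by simp) hc hne
    · have : ∃ z', w {a, b, z'} ≠ 0 ∧ z' ≠ z := by
        by_contra! hno
        exact ho ⟨hb, hno⟩
      obtain ⟨z', h0', hz'⟩ := this
      exact (hw.le_two hnb.2.1 hnb.1 hbz.symm (by simp) (by simp) (by simp) (by simp) (by simp) hc
        hne (by simp) (by simp) h0' (hw.triple_ne hb (Ne.symm hz'))).trans (by omega)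
  have key : ∀ z ∈ Z, g z + w {a, x, z} + w {a, y, z} ≤ 6 + e x z + e y z := by
    intro z hz
    have hxz : x ≠ z := fun h => hxZ (h ▸ hz)
    have hyz : y ≠ z := fun h => hyZ (h ▸ hz)
    have h1 := hone x z
    have h2 := hone y z
    have h4 := hg4 z hz
    by_cases hx : w {a, x, z} = 0 <;> by_cases hy : w {a, y, z} = 0
    · omega
    · have := hg2 z hz (.inr hy)
      omega
    · have := hg2 z hz (.inl hx)
      omega
    · have := hg2 z hz (.inl hx)
      have := htwo x y z hxy hxz hyz hx hy
      have := htwo y x z hxy.symm hyz hxz hy hx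
      omega
  have hsum := Finset.sum_le_sum key
  simp only [Finset.sum_add_distrib, Finset.sum_const, smul_eq_mul] at hsum
  have := he x
  have := he y
  omega

variable [Fintype α]

/-- All triples, except possibly one, contain two of the three points `p`, `q`, `x`. -/
theorem total_le_of_triangle {p q x : α} (h : IsHeavyPair w p q) (hxp : x ≠ p) (hxq : x ≠ q)
    (U : Finset α)
    (hcov : ∀ T, w T ≠ 0 → p ∈ T ∧ q ∈ T ∨ p ∈ T ∧ x ∈ T ∨ q ∈ T ∧ x ∈ T ∨ T = U) :
    ∑ T, w T ≤ 6 * Fintype.card α + 2 := by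
  set Z : Finset α := {p, q, x}ᶜ with hZ
  have hmemZ : ∀ z, z ∈ Z ↔ z ≠ x ∧ z ≠ q ∧ z ≠ p := by simp [hZ]; tauto
  have hZc : Z.card + 3 = Fintype.card α := by
    rw [← Finset.card_compl_add_card {p, q, x}, Finset.card_eq_three.2
      ⟨p, q, x, h.ne, hxp.symm, hxq.symm, rfl⟩]
  have htot : ∑ T, w T = mass w fun _ => True := by simp [mass]
  have h1 : mass w (fun _ => True) ≤ mass w (fun T => p ∈ T ∧ q ∈ T) +
      mass w (fun T => ¬(p ∈ T ∧ q ∈ T)) := mass_le_add fun T _ _ => em _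
  have h2 : mass w (fun T => ¬(p ∈ T ∧ q ∈ T)) ≤ mass w (fun T => T = U) +
      mass w (fun T => ¬(p ∈ T ∧ q ∈ T) ∧ (p ∈ T ∧ x ∈ T ∨ q ∈ T ∧ x ∈ T)) :=
    mass_le_add fun T hT hn => by have := hcov T hT; tauto
  have h3 : mass w (fun T => ¬(p ∈ T ∧ q ∈ T) ∧ (p ∈ T ∧ x ∈ T ∨ q ∈ T ∧ x ∈ T)) ≤
      mass w (fun T => q ∉ T ∧ p ∈ T ∧ x ∈ T) + mass w (fun T => p ∉ T ∧ q ∈ T ∧ x ∈ T) :=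
    mass_le_add fun T hT hn => by tauto
  have h4 : mass w (fun T => T = U) ≤ 8 := by
    simpa [mass, Finset.sum_filter] using hw.le_eight U
  have h5 : mass w (fun T => p ∈ T ∧ q ∈ T) ≤ ∑ z ∈ insert x Z, w {p, q, z} :=
    hw.mass_pair_le h.ne _ (fun _ _ h => h) fun z hzp hzq _ _ => by
      simp only [Finset.mem_insert, hmemZ]; tauto
  have h6 : mass w (fun T => q ∉ T ∧ p ∈ T ∧ x ∈ T) ≤ ∑ z ∈ Z, w {x, p, z} :=
    hw.mass_pair_le hxp _ (fun _ _ h => ⟨h.2.2, h.2.1⟩) fun z hzx hzp _ hq => by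
      refine (hmemZ z).2 ⟨hzx, fun h => hq.1 (by simp [h]), hzp⟩
  have h7 : mass w (fun T => p ∉ T ∧ q ∈ T ∧ x ∈ T) ≤ ∑ z ∈ Z, w {x, q, z} :=
    hw.mass_pair_le hxq _ (fun _ _ h => ⟨h.2.2, h.2.1⟩) fun z hzx hzq _ hp => by
      refine (hmemZ z).2 ⟨hzx, hzq, fun h => hp.1 (by simp [h])⟩
  rw [Finset.sum_insert (by simp [hmemZ])] at h5
  have h8 := hw.sum_two_pairs_le (a := x) h.ne Z (by simp [hmemZ]) (by simp [hmemZ])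
    (fun z => w {p, q, z}) (fun z _ => h.le_four z) fun z hz hor => by
      obtain ⟨hzx, hzq, hzp⟩ := (hmemZ z).1 hz
      rcases hor with h0 | h0
      · exact h.le_two_left z _ h0 hzp hzq (by simp) (by simp)
          (by simp [h.ne.symm, hxq.symm, hzq.symm])
      · exact h.le_two_right z _ h0 hzp hzq (by simp) (by simp) (by simp [h.ne, hxp.symm, hzp.symm])
  have h9 := h.le_four x
  omega

/-- All triples through `q` but not `p` contain `x`; a triple through `p` that avoids `q` and `x`
leaves room for only two of them. -/
theorem total_le_of_right_star {p q x y u v : α} (h : IsHeavyPair w p q)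
    (hcov : ∀ T, w T ≠ 0 → p ∈ T ∨ q ∈ T) (hx : ∀ T, w T ≠ 0 → p ∉ T → x ∈ T)
    (hxp : x ≠ p) (hyp : y ≠ p) (hqxy : w {q, x, y} ≠ 0) (hpuv : w {p, u, v} ≠ 0)
    (hxu : x ≠ u) (hxv : x ≠ v) (hqu : q ≠ u) (hqv : q ≠ v) :
    ∑ T, w T ≤ 6 * Fintype.card α := by
  obtain ⟨hqx, hqy, hxy⟩ := hw.ne_of_pair hqxy
  obtain ⟨hpu, hpv, huv⟩ := hw.ne_of_pair hpuv
  set Z : Finset α := {p, q, x, y}ᶜ with hZ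
  have hmemZ : ∀ z, z ∈ Z ↔ z ≠ y ∧ z ≠ x ∧ z ≠ q ∧ z ≠ p := by
    simp [hZ]; tauto
  have hZc : Z.card + 4 = Fintype.card α := by
    rw [← Finset.card_compl_add_card {p, q, x, y}, Finset.card_insert_of_notMem
      (by simp [h.ne, hxp.symm, hyp.symm]), Finset.card_eq_three.2 ⟨q, x, y, hqx, hqy, hxy, rfl⟩]
  have htot : ∑ T, w T = mass w fun _ => True := by simp [mass]
  have h1 : mass w (fun _ => True) ≤ mass w (fun T => p ∉ T) + mass w (fun T => p ∈ T) :=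
    mass_le_add fun T _ _ => (em _).symm
  have h2 : mass w (fun T => p ∉ T) ≤ 8 := by
    refine (hw.mass_pair_le hqx {u, v} (fun T hT hp => ⟨(hcov T hT).resolve_left hp, hx T hT hp⟩)
      fun z hzq hzx hz hp => ?_).trans (hw.sum_pair_le_eight Finset.card_le_two)
    obtain ⟨c, hc, hc'⟩ := hw.inter hpuv hz
    simp only [Finset.mem_insert, Finset.mem_singleton] at hc hc' hp ⊢
    rcases hc with rfl | rfl | rfl <;> rcases hc' with rfl | rfl | rfl <;> simp_all
  have h3 : mass w (fun T => p ∈ T) ≤ mass w (fun T => p ∈ T ∧ q ∈ T) +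
      mass w (fun T => p ∈ T ∧ q ∉ T) := mass_le_add fun T _ hp => by tauto
  have h4 : mass w (fun T => p ∈ T ∧ q ∉ T) ≤ mass w (fun T => T = {p, x, y}) +
      mass w (fun T => (p ∈ T ∧ q ∉ T ∧ (x ∈ T ∨ y ∈ T)) ∧ T ≠ {p, x, y}) :=
    mass_le_add fun T hT hp => by
      obtain ⟨c, hc, hc'⟩ := hw.inter hqxy hT
      simp only [Finset.mem_insert, Finset.mem_singleton] at hc
      rcases hc with rfl | rfl | rfl <;> tauto
  have h5 : mass w (fun T => (p ∈ T ∧ q ∉ T ∧ (x ∈ T ∨ y ∈ T)) ∧ T ≠ {p, x, y}) ≤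
      mass w (fun T => p ∈ T ∧ q ∉ T ∧ x ∈ T ∧ T ≠ {p, x, y}) +
      mass w (fun T => p ∈ T ∧ q ∉ T ∧ y ∈ T ∧ T ≠ {p, x, y}) :=
    mass_le_add fun T hT hp => by tauto
  have h6 : mass w (fun T => T = {p, x, y}) ≤ 4 := by
    simp only [mass, Finset.sum_filter, Finset.sum_ite_eq', Finset.mem_univ, if_true]
    refine hw.le_four (a := x) (b := y) hxy (by simp) (by simp) (by simp) (by simp) hqxy fun he => ?_
    have : p ∈ ({q, x, y} : Finset α) := he ▸ by simp
    simp [h.ne, hxp.symm, hyp.symm] at this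
  have h7 : mass w (fun T => p ∈ T ∧ q ∈ T) ≤ ∑ z ∈ insert x (insert y Z), w {p, q, z} :=
    hw.mass_pair_le h.ne _ (fun _ _ h => h) fun z hzp hzq _ _ => by
      simp only [Finset.mem_insert, hmemZ]; tauto
  have h8 : mass w (fun T => p ∈ T ∧ q ∉ T ∧ x ∈ T ∧ T ≠ {p, x, y}) ≤ ∑ z ∈ Z, w {p, x, z} :=
    hw.mass_pair_le hxp.symm _ (fun _ _ h => ⟨h.1, h.2.2.1⟩) fun z hzp hzx _ hq =>
      (hmemZ z).2 ⟨fun h => hq.2.2.2 (h ▸ rfl), hzx, fun h => hq.2.1 (by simp [h]), hzp⟩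
  have h9 : mass w (fun T => p ∈ T ∧ q ∉ T ∧ y ∈ T ∧ T ≠ {p, x, y}) ≤ ∑ z ∈ Z, w {p, y, z} :=
    hw.mass_pair_le hyp.symm _ (fun _ _ h => ⟨h.1, h.2.2.1⟩) fun z hzp hzy _ hq =>
      (hmemZ z).2 ⟨hzy, fun h => hq.2.2.2 (by rw [h, Finset.pair_comm]),
        fun h => hq.2.1 (by simp [h]), hzp⟩
  rw [Finset.sum_insert (by simp [hmemZ, hxy]), Finset.sum_insert (by simp [hmemZ])] at h7
  have h10 := hw.sum_two_pairs_le (a := p) hxy Z (by simp [hmemZ]) (by simp [hmemZ])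
    (fun z => w {p, q, z}) (fun z _ => h.le_four z) fun z hz hor => by
      obtain ⟨hzy, hzx, hzq, hzp⟩ := (hmemZ z).1 hz
      rcases hor with h0 | h0
      · exact h.le_two_left z _ h0 hzp hzq (by simp) (by simp) (by simp [h.ne.symm, hqx, hzq.symm])
      · exact h.le_two_left z _ h0 hzp hzq (by simp) (by simp) (by simp [h.ne.symm, hqy, hzq.symm])
  have hp : p ∉ ({q, x, y} : Finset α) := by simp [h.ne, hxp.symm, hyp.symm]
  have h11 := h.le_two_right x _ hqxy hxp hqx.symm (by simp) (by simp) hp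
  have h12 := h.le_two_right y _ hqxy hyp hqy.symm (by simp) (by simp) hp
  omega

/-- If no point other than `q` lies in all triples through `q` that avoid `p`, then the triples
through `p` that avoid `q` weigh at most `16`: for a triple `{q, x, y}`, each of them contains `x`
or `y`, and a triple `{q, c, d}` without `x` leaves only `{p, x, c}` and `{p, x, d}`. -/
theorem mass_left_le {p q x y : α} (hqp : q ≠ p) (hxp : x ≠ p) (hyp : y ≠ p)
    (hqxy : w {q, x, y} ≠ 0)
    (hno : ∀ x, x ≠ q → ∃ T, w T ≠ 0 ∧ q ∈ T ∧ p ∉ T ∧ x ∉ T) :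
    mass w (fun T => p ∈ T ∧ q ∉ T) ≤ 16 := by
  obtain ⟨hqx, hqy, hxy⟩ := hw.ne_of_pair hqxy
  have hthrough : ∀ x, x ≠ q → x ≠ p → mass w (fun T => p ∈ T ∧ q ∉ T ∧ x ∈ T) ≤ 8 := by
    intro x hxq hxp
    obtain ⟨T, hT, hqT, hpT, hxT⟩ := hno x hxq
    have hc : (T.erase q).card = 2 := by rw [Finset.card_erase_of_mem hqT, hw.card_eq hT]
    refine (hw.mass_pair_le hxp.symm (T.erase q) (fun _ _ h => ⟨h.1, h.2.2⟩)
      fun z hzp hzx hz hQ => ?_).trans (hw.sum_pair_le_eight hc.le)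
    obtain ⟨c, hc, hc'⟩ := hw.inter hT hz
    simp only [Finset.mem_insert, Finset.mem_singleton] at hc'
    rcases hc' with rfl | rfl | rfl
    · exact absurd hc hpT
    · exact absurd hc hxT
    · exact Finset.mem_erase.2 ⟨fun h => hQ.2.1 (by simp [h]), hc⟩
  have h1 : mass w (fun T => p ∈ T ∧ q ∉ T) ≤ mass w (fun T => p ∈ T ∧ q ∉ T ∧ x ∈ T) +
      mass w (fun T => p ∈ T ∧ q ∉ T ∧ y ∈ T) := mass_le_add fun T hT hp => by
    obtain ⟨c, hc, hc'⟩ := hw.inter hqxy hT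
    simp only [Finset.mem_insert, Finset.mem_singleton] at hc
    rcases hc with rfl | rfl | rfl <;> tauto
  have := hthrough x hqx.symm hxp
  have := hthrough y hqy.symm hyp
  omega

/-- Neither the triples through `p` only nor those through `q` only have a further common
point. Each of these two families weighs at most `16`, and two of the triples through `{p, q}` weigh
at most `2` instead of `4`. -/
theorem total_le_of_no_star {p q : α} (h : IsHeavyPair w p q)
    (hcov : ∀ T, w T ≠ 0 → p ∈ T ∨ q ∈ T)
    (hp : ∀ x, x ≠ p → ∃ T, w T ≠ 0 ∧ p ∈ T ∧ q ∉ T ∧ x ∉ T)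
    (hq : ∀ x, x ≠ q → ∃ T, w T ≠ 0 ∧ q ∈ T ∧ p ∉ T ∧ x ∉ T) :
    ∑ T, w T ≤ 4 * Fintype.card α + 20 := by
  have hthird : ∀ {T a b}, a ≠ b → w T ≠ 0 → a ∈ T → b ∉ T →
      ∃ x y, x ≠ b ∧ y ≠ b ∧ T = {a, x, y} := by
    intro T a b hab hT ha hb
    have hc : (T.erase a).card = 2 := by rw [Finset.card_erase_of_mem ha, hw.card_eq hT]
    obtain ⟨x, y, -, he⟩ := Finset.card_eq_two.1 hc
    have hTe : T = {a, x, y} := by rw [← he, Finset.insert_erase ha]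
    exact ⟨x, y, fun h => hb (by simp [hTe, h]), fun h => hb (by simp [hTe, h]), hTe⟩
  obtain ⟨S, hS, hpS, hqS, -⟩ := hp q h.ne.symm
  obtain ⟨T, hT, hqT, hpT, -⟩ := hq p h.ne
  obtain ⟨u, v, huq, hvq, rfl⟩ := hthird h.ne hS hpS hqS
  obtain ⟨x, y, hxp, hyp, rfl⟩ := hthird h.ne.symm hT hqT hpT
  obtain ⟨hqx, hqy, hxy⟩ := hw.ne_of_pair hT
  have htot : ∑ T, w T = mass w fun _ => True := by simp [mass]
  have h1 : mass w (fun _ => True) ≤ mass w (fun T => p ∈ T ∧ q ∈ T) +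
      mass w (fun T => ¬(p ∈ T ∧ q ∈ T)) := mass_le_add fun T _ _ => em _
  have h2 : mass w (fun T => ¬(p ∈ T ∧ q ∈ T)) ≤ mass w (fun T => p ∈ T ∧ q ∉ T) +
      mass w (fun T => q ∈ T ∧ p ∉ T) :=
    mass_le_add fun T hT hn => by have := hcov T hT; tauto
  have h3 := hw.mass_left_le h.ne.symm hxp hyp hT hq
  have h4 := hw.mass_left_le h.ne huq hvq hS hp
  set Z : Finset α := {p, q, x, y}ᶜ with hZ
  have hmemZ : ∀ z, z ∈ Z ↔ z ≠ y ∧ z ≠ x ∧ z ≠ q ∧ z ≠ p := by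
    simp [hZ]; tauto
  have hZc : Z.card + 4 = Fintype.card α := by
    rw [← Finset.card_compl_add_card {p, q, x, y}, Finset.card_insert_of_notMem
      (by simp [h.ne, hxp.symm, hyp.symm]), Finset.card_eq_three.2 ⟨q, x, y, hqx, hqy, hxy, rfl⟩]
  have h5 : mass w (fun T => p ∈ T ∧ q ∈ T) ≤ ∑ z ∈ insert x (insert y Z), w {p, q, z} :=
    hw.mass_pair_le h.ne _ (fun _ _ h => h) fun z hzp hzq _ _ => by
      simp only [Finset.mem_insert, hmemZ]; tauto
  rw [Finset.sum_insert (by simp [hmemZ, hxy]), Finset.sum_insert (by simp [hmemZ])] at h5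
  have h6 := Finset.sum_le_card_nsmul Z (fun z => w {p, q, z}) 4 fun z _ => h.le_four z
  rw [smul_eq_mul] at h6
  have h7 := h.le_two_right x _ hT hxp hqx.symm (by simp) (by simp) hpT
  have h8 := h.le_two_right y _ hT hyp hqy.symm (by simp) (by simp) hpT
  omega

end IsSignWeight

namespace IsSignWeight

variable {α : Type*} [DecidableEq α] [Fintype α] {w : Finset α → ℕ} (hw : IsSignWeight w)
include hw

/-- The pair `{p, q}` meets every triple, and the triples through `q` that avoid `p` share a further
point `x`. Either `x` also lies in all triples through `p` that avoid `q`, or some triple through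
`p` avoids both `q` and `x`. -/
theorem total_le_of_common_point {p q x : α} (h : IsHeavyPair w p q)
    (hcov : ∀ T, w T ≠ 0 → p ∈ T ∨ q ∈ T) (hstar : ∀ x, ∃ T, w T ≠ 0 ∧ x ∉ T) (hxq : x ≠ q)
    (hx : ∀ T, w T ≠ 0 → q ∈ T → p ∉ T → x ∈ T) :
    ∑ T, w T ≤ 6 * Fintype.card α + 2 := by
  obtain ⟨T, hT, hpT⟩ := hstar p
  have hqT := (hcov T hT).resolve_left hpT
  have hxT := hx T hT hqT hpT
  have hxp : x ≠ p := fun he => hpT (he ▸ hxT)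
  by_cases hA : ∀ T, w T ≠ 0 → p ∈ T → q ∉ T → x ∈ T
  · refine hw.total_le_of_triangle h hxp hxq ∅ fun T hT => ?_
    have := hcov T hT
    have := hx T hT
    have := hA T hT
    tauto
  · push Not at hA
    obtain ⟨S, hS, hpS, hqS, hxS⟩ := hA
    have hc : (S.erase p).card = 2 := by rw [Finset.card_erase_of_mem hpS, hw.card_eq hS]
    obtain ⟨u, v, -, he⟩ := Finset.card_eq_two.1 hc
    obtain rfl : S = {p, u, v} := by rw [← he, Finset.insert_erase hpS]
    obtain ⟨y, -, -, rfl⟩ := hw.exists_third hT hxq.symm hqT hxT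
    simp only [Finset.mem_insert, Finset.mem_singleton, not_or] at hpT hqS hxS
    exact (hw.total_le_of_right_star h hcov
      (fun T hT hp => hx T hT ((hcov T hT).resolve_left hp) hp) hxp (Ne.symm hpT.2.2) hT hS
      hxS.2.1 hxS.2.2 hqS.2.1 hqS.2.2).trans (by omega)

/-- A family without common point in which the triples through some pair weigh more than `8`. At
least three triples contain this pair; if a triple `U` is disjoint from the pair, then `U` consists
of their third points, and all triples but `U` contain two of `p`, `q` and some `x ∈ U`. -/
theorem total_le_of_heavy {p q : α} (hstar : ∀ x, ∃ T, w T ≠ 0 ∧ x ∉ T)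
    (hheavy : 8 < ∑ z, w {p, q, z}) :
    ∑ T, w T ≤ max (6 * Fintype.card α + 2) (4 * Fintype.card α + 20) := by
  have hthree : 2 < (Finset.univ.filter fun z => w {p, q, z} ≠ 0).card := by
    by_contra! hle
    have := hw.sum_pair_le_eight (a := p) (b := q) hle
    rw [Finset.sum_filter_ne_zero] at this
    omega
  obtain ⟨a, b, c, ha, hb, hc, hab, hac, hbc⟩ := Finset.two_lt_card_iff.1 hthree
  simp only [Finset.mem_filter, Finset.mem_univ, true_and] at ha hb hc
  have h := hw.isHeavyPair_of_two ha hb hab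
  by_cases hcov : ∀ T, w T ≠ 0 → p ∈ T ∨ q ∈ T
  · by_cases hp : ∀ x, x ≠ p → ∃ T, w T ≠ 0 ∧ p ∈ T ∧ q ∉ T ∧ x ∉ T
    · by_cases hq : ∀ x, x ≠ q → ∃ T, w T ≠ 0 ∧ q ∈ T ∧ p ∉ T ∧ x ∉ T
      · exact le_max_of_le_right (hw.total_le_of_no_star h hcov hp hq)
      · push Not at hq
        obtain ⟨x, hxq, hx⟩ := hq
        exact le_max_of_le_left (hw.total_le_of_common_point h hcov hstar hxq hx)
    · push Not at hp
      obtain ⟨x, hxp, hx⟩ := hp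
      exact le_max_of_le_left (hw.total_le_of_common_point h.symm
        (fun T hT => (hcov T hT).symm) hstar hxp hx)
  · push Not at hcov
    obtain ⟨U, hU, hpU, hqU⟩ := hcov
    have hmem : ∀ {z T}, w {p, q, z} ≠ 0 → w T ≠ 0 → p ∉ T → q ∉ T → z ∈ T := by
      intro z T hz hT hpT hqT
      obtain ⟨d, hd, hdT⟩ := hw.inter hz hT
      simp only [Finset.mem_insert, Finset.mem_singleton] at hd
      rcases hd with rfl | rfl | rfl
      exacts [absurd hdT hpT, absurd hdT hqT, hdT]
    have hTe : ∀ T, w T ≠ 0 → p ∉ T → q ∉ T → T = {a, b, c} := fun T hT hpT hqT =>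
      (Finset.eq_of_subset_of_card_le (by
        simp [Finset.insert_subset_iff, hmem ha hT hpT hqT, hmem hb hT hpT hqT,
          hmem hc hT hpT hqT])
        (by rw [hw.card_eq hT, Finset.card_eq_three.2 ⟨a, b, c, hab, hac, hbc, rfl⟩])).symm
    have hUe := hTe U hU hpU hqU
    -- at most one of the three triples through `{p, q}` has weight at most `2`
    have hx : ∃ x ∈ U, ∀ z ∈ U, w {p, q, z} ≤ 2 → z = x := by
      have hsum : ∑ z, w {p, q, z} ≤ ∑ z ∈ ({a, b, c} : Finset α), w {p, q, z} := by
        refine (Finset.sum_subset (Finset.subset_univ _) fun z _ hz => ?_).ge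
        by_contra h0
        exact hz (hUe ▸ hmem h0 hU hpU hqU)
      rw [Finset.sum_insert (by simp [hab, hac]), Finset.sum_pair hbc] at hsum
      have ha4 := h.le_four a
      have hb4 := h.le_four b
      have hc4 := h.le_four c
      have hin : a ∈ U ∧ b ∈ U ∧ c ∈ U := by simp [hUe]
      have hall : ∀ z ∈ U, z = a ∨ z = b ∨ z = c := by simp [hUe]
      by_cases ha2 : w {p, q, a} ≤ 2
      · refine ⟨a, hin.1, fun z hz hz2 => ?_⟩
        rcases hall z hz with rfl | rfl | rfl <;> first | rfl | omega
      · by_cases hb2 : w {p, q, b} ≤ 2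
        · refine ⟨b, hin.2.1, fun z hz hz2 => ?_⟩
          rcases hall z hz with rfl | rfl | rfl <;> first | rfl | omega
        · refine ⟨c, hin.2.2, fun z hz hz2 => ?_⟩
          rcases hall z hz with rfl | rfl | rfl <;> first | rfl | omega
    obtain ⟨x, hxU, hx⟩ := hx
    refine le_max_of_le_left (hw.total_le_of_triangle h (fun he => hpU (he ▸ hxU))
      (fun he => hqU (he ▸ hxU)) U fun T hT => ?_)
    obtain ⟨z, hzU, hzT⟩ := hw.inter hU hT
    have hzp : z ≠ p := fun he => hpU (he ▸ hzU)
    have hzq : z ≠ q := fun he => hqU (he ▸ hzU)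
    by_cases hpT : p ∈ T <;> by_cases hqT : q ∈ T
    · exact .inl ⟨hpT, hqT⟩
    · have := hx z hzU (h.le_two_left z T hT hzp hzq hzT hpT hqT)
      exact .inr (.inl ⟨hpT, this ▸ hzT⟩)
    · have := hx z hzU (h.le_two_right z T hT hzp hzq hzT hqT hpT)
      exact .inr (.inr (.inl ⟨hqT, this ▸ hzT⟩))
    · exact .inr (.inr (.inr ((hTe T hT hpT hqT).trans hUe.symm)))

theorem total_le (hα : 9 ≤ Fintype.card α) :
    ∑ T, w T ≤ (Fintype.card α - 1) * (Fintype.card α - 2) := by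
  by_cases hstar : ∀ x, ∃ T, w T ≠ 0 ∧ x ∉ T
  · have hbound : max (6 * Fintype.card α + 2) (4 * Fintype.card α + 20) ≤
        (Fintype.card α - 1) * (Fintype.card α - 2) := by
      obtain ⟨k, hk⟩ := Nat.exists_eq_add_of_le hα
      rw [hk, show 9 + k - 1 = k + 8 by omega, show 9 + k - 2 = k + 7 by omega]
      exact max_le (by nlinarith) (by nlinarith)
    by_cases hlight : ∀ a b : α, a ≠ b → ∑ z, w {a, b, z} ≤ 8
    · have := hw.total_le_of_light hstar hlight
      have := le_max_left (6 * Fintype.card α + 2) (4 * Fintype.card α + 20)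
      omega
    · push Not at hlight
      obtain ⟨p, q, -, hheavy⟩ := hlight
      exact (hw.total_le_of_heavy hstar hheavy).trans hbound
  · push Not at hstar
    obtain ⟨x, hx⟩ := hstar
    exact hw.total_le_of_star (by omega) x hx

end IsSignWeight

/-! ### Supports of vectors in an independent set -/

section SignedJohnson

variable {n : ℕ}

/-- The set of nonzero coordinates of a vector. -/
def vecSupport (v : Fin n → ℤ) : Finset (Fin n) := Finset.univ.filter fun i => v i ≠ 0

theorem mem_vecSupport {v : Fin n → ℤ} {i : Fin n} : i ∈ vecSupport v ↔ v i ≠ 0 := by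
  simp [vecSupport]

theorem dotProduct_eq_sum_inter (u v : Fin n → ℤ) :
    u ⬝ᵥ v = ∑ i ∈ vecSupport u ∩ vecSupport v, u i * v i := by
  refine (Finset.sum_subset (Finset.subset_univ _) fun i _ hi => ?_).symm
  simp only [Finset.mem_inter, mem_vecSupport, not_and_or, not_not] at hi
  rcases hi with h | h <;> simp [h]

theorem eq_one_or_neg_one_of_mem_vecSupport {k : ℕ} (v : SignedJohnsonVertex n k) {i : Fin n}
    (hi : i ∈ vecSupport v.1) : v.1 i = 1 ∨ v.1 i = -1 := by
  have := v.2.1 i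
  simp only [Set.mem_insert_iff, Set.mem_singleton_iff] at this
  rw [mem_vecSupport] at hi
  tauto

/-- The supports meet exactly in `{a, b}`, so the scalar product is a sum of two signs, and it
vanishes unless these signs agree. -/
theorem mul_eq_mul_of_not_adj {u v : SignedJohnsonVertex n 3} {a b : Fin n} (hab : a ≠ b)
    (hau : a ∈ vecSupport u.1) (hbu : b ∈ vecSupport u.1) (hav : a ∈ vecSupport v.1)
    (hbv : b ∈ vecSupport v.1) (hne : vecSupport u.1 ≠ vecSupport v.1)
    (hadj : ¬(signedJohnsonGraph n 3 0).Adj u v) :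
    u.1 a * u.1 b = v.1 a * v.1 b := by
  have hinter : vecSupport u.1 ∩ vecSupport v.1 = {a, b} := by
    refine (Finset.eq_of_subset_of_card_le (by
      simp [Finset.insert_subset_iff, hau, hbu, hav, hbv]) ?_).symm
    rw [Finset.card_pair hab]
    by_contra! hlt
    have hu : (vecSupport u.1).card = 3 := u.2.2
    have hv : (vecSupport v.1).card = 3 := v.2.2
    have h1 := Finset.eq_of_subset_of_card_le
      (Finset.inter_subset_left (s₁ := vecSupport u.1) (s₂ := vecSupport v.1)) (by omega)
    have h2 := Finset.eq_of_subset_of_card_le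
      (Finset.inter_subset_right (s₁ := vecSupport u.1) (s₂ := vecSupport v.1)) (by omega)
    exact hne (h1.symm.trans h2)
  have hdot : u.1 ⬝ᵥ v.1 ≠ 0 := fun h => hadj ⟨fun h => hne (h ▸ rfl), h⟩
  rw [dotProduct_eq_sum_inter, hinter, Finset.sum_pair hab] at hdot
  rcases eq_one_or_neg_one_of_mem_vecSupport u hau with h1 | h1 <;>
  rcases eq_one_or_neg_one_of_mem_vecSupport u hbu with h2 | h2 <;>
  rcases eq_one_or_neg_one_of_mem_vecSupport v hav with h3 | h3 <;>
  rcases eq_one_or_neg_one_of_mem_vecSupport v hbv with h4 | h4 <;>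
  simp_all

theorem vec_ext {u v : SignedJohnsonVertex n 3} {T : Finset (Fin n)} (hu : vecSupport u.1 = T)
    (hv : vecSupport v.1 = T) (h : ∀ i ∈ T, u.1 i = v.1 i) : u = v := by
  refine Subtype.ext (funext fun i => ?_)
  by_cases hi : i ∈ T
  · exact h i hi
  · have h1 : i ∉ vecSupport u.1 := hu ▸ hi
    have h2 : i ∉ vecSupport v.1 := hv ▸ hi
    rw [mem_vecSupport, not_not] at h1 h2
    rw [h1, h2]

open Classical in
/-- A triple carries at most `2 ^ 3` sign patterns, and each of its pairs that lies in the support of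
another vector fixes one product of two signs. -/
theorem isSignWeight_of_isIndepSet {S : Finset (SignedJohnsonVertex n 3)}
    (hS : (signedJohnsonGraph n 3 0).IsIndepSet S) :
    IsSignWeight fun T => (S.filter fun v => vecSupport v.1 = T).card := by
  have hadj : ∀ u ∈ S, ∀ v ∈ S, ¬(signedJohnsonGraph n 3 0).Adj u v := fun u hu v hv h =>
    hS hu hv h.1 h
  have hex : ∀ {T}, (S.filter fun v => vecSupport v.1 = T).card ≠ 0 →
      ∃ v ∈ S, vecSupport v.1 = T := fun h => by
    obtain ⟨v, hv⟩ := Finset.card_ne_zero.1 h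
    exact ⟨v, Finset.mem_filter.1 hv⟩
  have hsign : ∀ {v : SignedJohnsonVertex n 3} {T a}, vecSupport v.1 = T → a ∈ T →
      v.1 a ∈ ({1, -1} : Finset ℤ) := fun {v T a} hv ha => by
    simpa using eq_one_or_neg_one_of_mem_vecSupport v (hv ▸ ha)
  have hcancel : ∀ {u v : SignedJohnsonVertex n 3} {T a b}, vecSupport v.1 = T → a ∈ T →
      u.1 a = v.1 a → u.1 a * u.1 b = v.1 a * v.1 b → u.1 b = v.1 b := by
    intro u v T a b hv ha he hm
    rw [he] at hm
    exact mul_left_cancel₀ (mem_vecSupport.1 (hv ▸ ha)) hm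
  have hthree : ∀ {T : Finset (Fin n)} {a b}, T.card = 3 → a ≠ b → a ∈ T → b ∈ T →
      ∃ c, c ∈ T ∧ ∀ i ∈ T, i = a ∨ i = b ∨ i = c := by
    intro T a b hT hab ha hb
    have h : ((T.erase a).erase b).card = 1 := by
      rw [Finset.card_erase_of_mem (by simp [hab.symm, hb]), Finset.card_erase_of_mem ha, hT]
    obtain ⟨c, hc⟩ := Finset.card_eq_one.1 h
    have hc' : c ∈ (T.erase a).erase b := by simp [hc]
    refine ⟨c, Finset.mem_of_mem_erase (Finset.mem_of_mem_erase hc'), fun i hi => ?_⟩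
    by_contra! hno
    exact hno.2.2 (by
      have : i ∈ (T.erase a).erase b := by simp [hno.1, hno.2.1, hi]
      simpa [hc] using this)
  have hcard : ∀ {T}, (S.filter fun v => vecSupport v.1 = T).card ≠ 0 → T.card = 3 := fun h => by
    obtain ⟨v, -, rfl⟩ := hex h
    exact v.2.2
  refine ⟨hcard, ?_, ?_, ?_, ?_⟩
  · intro T U hT hU
    obtain ⟨u, hu, rfl⟩ := hex hT
    obtain ⟨v, hv, rfl⟩ := hex hU
    by_contra! hno
    have hpos : (vecSupport u.1).Nonempty := Finset.card_pos.1 (by rw [hcard hT]; omega)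
    obtain ⟨a, ha⟩ := hpos
    refine hadj u hu v hv ⟨fun h => hno a ha (h ▸ ha), ?_⟩
    rw [dotProduct_eq_sum_inter, Finset.disjoint_iff_inter_eq_empty.1
      (Finset.disjoint_left.2 hno), Finset.sum_empty]
  · intro T
    by_cases h0 : (S.filter fun v => vecSupport v.1 = T).card = 0
    · simp [h0]
    obtain ⟨a, b, c, -, -, -, hT⟩ := Finset.card_eq_three.1 (hcard h0)
    refine (Finset.card_le_card_of_injOn (fun v => (v.1 a, v.1 b, v.1 c))
      (t := ({1, -1} : Finset ℤ) ×ˢ ({1, -1} : Finset ℤ) ×ˢ ({1, -1} : Finset ℤ)) ?_ ?_).trans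
      (by simp)
    · intro v hv
      have hv := (Finset.mem_filter.1 hv).2
      simp only [Finset.coe_product, Set.mem_prod, Finset.mem_coe]
      exact ⟨hsign hv (by simp [hT]), hsign hv (by simp [hT]), hsign hv (by simp [hT])⟩
    · intro u hu v hv huv
      simp only [Prod.mk.injEq] at huv
      refine vec_ext (Finset.mem_filter.1 hu).2 (Finset.mem_filter.1 hv).2 fun i hi => ?_
      rw [hT] at hi
      simp only [Finset.mem_insert, Finset.mem_singleton] at hi
      rcases hi with rfl | rfl | rfl
      exacts [huv.1, huv.2.1, huv.2.2]
  · intro a b T U hab haT hbT haU hbU hU hTU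
    by_cases h0 : (S.filter fun v => vecSupport v.1 = T).card = 0
    · simp [h0]
    obtain ⟨r, hr, rfl⟩ := hex hU
    obtain ⟨c, hcT, hT⟩ := hthree (hcard h0) hab haT hbT
    have hmul : ∀ v ∈ S, vecSupport v.1 = T → v.1 a * v.1 b = r.1 a * r.1 b := by
      rintro v hv rfl
      exact mul_eq_mul_of_not_adj hab haT hbT haU hbU hTU (hadj v hv r hr)
    -- the sign at `b` is determined by the sign at `a`
    refine (Finset.card_le_card_of_injOn (fun v => (v.1 a, v.1 c))
      (t := ({1, -1} : Finset ℤ) ×ˢ ({1, -1} : Finset ℤ)) ?_ ?_).trans (by simp)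
    · intro v hv
      have hv := (Finset.mem_filter.1 hv).2
      simp only [Finset.coe_product, Set.mem_prod, Finset.mem_coe]
      exact ⟨hsign hv haT, hsign hv hcT⟩
    · intro u hu v hv huv
      simp only [Prod.mk.injEq] at huv
      obtain ⟨huS, hu⟩ := Finset.mem_filter.1 hu
      obtain ⟨hvS, hv⟩ := Finset.mem_filter.1 hv
      refine vec_ext hu hv fun i hi => ?_
      rcases hT i hi with rfl | rfl | rfl
      · exact huv.1
      · exact hcancel hv haT huv.1 ((hmul u huS hu).trans (hmul v hvS hv).symm)
      · exact huv.2
  · intro a b c T U V hab hac hbc haT hbT hcT haU hbU hU hTU haV hcV hV hTV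
    by_cases h0 : (S.filter fun v => vecSupport v.1 = T).card = 0
    · simp [h0]
    obtain ⟨r, hr, rfl⟩ := hex hU
    obtain ⟨s, hs, rfl⟩ := hex hV
    have hT : T = {a, b, c} := (Finset.eq_of_subset_of_card_le
      (by simp [Finset.insert_subset_iff, haT, hbT, hcT])
      (by rw [hcard h0, Finset.card_eq_three.2 ⟨a, b, c, hab, hac, hbc, rfl⟩])).symm
    have hmul : ∀ v ∈ S, vecSupport v.1 = T → v.1 a * v.1 b = r.1 a * r.1 b := by
      rintro v hv rfl
      exact mul_eq_mul_of_not_adj hab haT hbT haU hbU hTU (hadj v hv r hr)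
    have hmul' : ∀ v ∈ S, vecSupport v.1 = T → v.1 a * v.1 c = s.1 a * s.1 c := by
      rintro v hv rfl
      exact mul_eq_mul_of_not_adj hac haT hcT haV hcV hTV (hadj v hv s hs)
    -- the signs at `b` and `c` are determined by the sign at `a`
    refine (Finset.card_le_card_of_injOn (fun v => v.1 a)
      (t := ({1, -1} : Finset ℤ)) ?_ ?_).trans (by simp)
    · exact fun v hv => hsign (Finset.mem_filter.1 hv).2 haT
    · intro u hu v hv huv
      obtain ⟨huS, hu⟩ := Finset.mem_filter.1 hu
      obtain ⟨hvS, hv⟩ := Finset.mem_filter.1 hv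
      refine vec_ext hu hv fun i hi => ?_
      rw [hT] at hi
      simp only [Finset.mem_insert, Finset.mem_singleton] at hi
      rcases hi with rfl | rfl | rfl
      · exact huv
      · exact hcancel hv haT huv ((hmul u huS hu).trans (hmul v hvS hv).symm)
      · exact hcancel hv haT huv ((hmul' u huS hu).trans (hmul' v hvS hv).symm)

theorem card_le_of_isIndepSet (hn : 9 ≤ n) {S : Finset (SignedJohnsonVertex n 3)}
    (hS : (signedJohnsonGraph n 3 0).IsIndepSet S) : S.card ≤ (n - 1) * (n - 2) := by
  classical
  have h := (isSignWeight_of_isIndepSet hS).total_le (by simpa using hn)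
  rw [Finset.card_eq_sum_card_fiberwise (f := fun v => vecSupport v.1) (t := Finset.univ)
    (by simp)]
  simpa using h

/-! ### A large independent set -/

/-- The vector with the value `ε` on `T` and `0` elsewhere. -/
def constVec (ε : ℤˣ) (T : Finset (Fin n)) : Fin n → ℤ := fun i => if i ∈ T then ε else 0

theorem vecSupport_constVec (ε : ℤˣ) (T : Finset (Fin n)) : vecSupport (constVec ε T) = T := by
  ext i
  simp [mem_vecSupport, constVec]

theorem constVec_dotProduct (ε δ : ℤˣ) (T U : Finset (Fin n)) :
    constVec ε T ⬝ᵥ constVec δ U = ε * δ * (T ∩ U).card := by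
  rw [dotProduct_eq_sum_inter, vecSupport_constVec, vecSupport_constVec, mul_comm, ← nsmul_eq_mul,
    ← Finset.sum_const]
  refine Finset.sum_congr rfl fun i hi => ?_
  rw [Finset.mem_inter] at hi
  simp [constVec, hi.1, hi.2]

/-- The constant-sign vectors whose support contains a fixed coordinate are independent. -/
theorem exists_isIndepSet (hn : 0 < n) : ∃ S : Finset (SignedJohnsonVertex n 3),
    (signedJohnsonGraph n 3 0).IsIndepSet S ∧ S.card = 2 * (n - 1).choose 2 := by
  classical
  let o : Fin n := ⟨0, hn⟩
  let P : Finset (ℤˣ × Finset (Fin n)) :=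
    Finset.univ ×ˢ (Finset.univ.erase o).powersetCard 2
  have hP : ∀ x ∈ P, o ∉ x.2 ∧ x.2.card = 2 := fun x hx => by
    have := Finset.mem_powersetCard.1 (Finset.mem_product.1 hx).2
    exact ⟨fun h => by simpa using this.1 h, this.2⟩
  let f : P → SignedJohnsonVertex n 3 := fun x =>
    ⟨constVec x.1.1 (insert o x.1.2), fun i => by
      rcases Int.units_eq_one_or x.1.1 with h | h <;> simp only [constVec, h] <;> split_ifs <;> simp,
      by
        change (vecSupport _).card = 3
        rw [vecSupport_constVec, Finset.card_insert_of_notMem (hP _ x.2).1, (hP _ x.2).2]⟩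
  have hf : Function.Injective f := fun x y hxy => by
    have hv : constVec x.1.1 (insert o x.1.2) = constVec y.1.1 (insert o y.1.2) :=
      congrArg Subtype.val hxy
    have hsupp := congrArg vecSupport hv
    rw [vecSupport_constVec, vecSupport_constVec] at hsupp
    have h2 : x.1.2 = y.1.2 := by
      rw [← Finset.erase_insert (hP _ x.2).1, hsupp, Finset.erase_insert (hP _ y.2).1]
    have h1 : x.1.1 = y.1.1 := Units.ext (by simpa [constVec] using congrFun hv o)
    exact Subtype.ext (Prod.ext h1 h2)
  refine ⟨Finset.univ.map ⟨f, hf⟩, ?_, ?_⟩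
  · intro u hu v hv _ hadj
    simp only [Finset.coe_map, Finset.coe_univ, Set.image_univ, Set.mem_range,
      Function.Embedding.coeFn_mk] at hu hv
    obtain ⟨x, rfl⟩ := hu
    obtain ⟨y, rfl⟩ := hv
    have h0 : constVec x.1.1 (insert o x.1.2) ⬝ᵥ constVec y.1.1 (insert o y.1.2) = 0 := hadj.2
    rw [constVec_dotProduct] at h0
    -- both supports contain `o`, so their intersection has nonzero size
    simp at h0
  · rw [Finset.card_map, Finset.card_univ, Fintype.card_coe]
    simp [P, Finset.card_product, Finset.card_powersetCard]

end SignedJohnson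

theorem mainTheorem6 (n : ℕ) (hn : 9 ≤ n) :
    (signedJohnsonGraph n 3 0).indepNum = 2 * (n - 1).choose 2 := by
  refine le_antisymm ?_ ?_
  · obtain ⟨S, hS⟩ := (signedJohnsonGraph n 3 0).exists_isNIndepSet_indepNum
    have h := card_le_of_isIndepSet hn hS.isIndepSet
    rw [hS.card_eq] at h
    rw [Nat.choose_two_right, Nat.mul_div_cancel' (Nat.even_mul_pred_self _).two_dvd]
    exact h
  · obtain ⟨S, hS, hc⟩ := exists_isIndepSet (n := n) (by omega)
    exact hc ▸ hS.card_le_indepNum
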